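/- Let $q$ be a prime power, $m\ge 2$, $\lambda\mid q-1$, $n=\lambda(q^m+1)$, and let $\zeta_n$ be a primitive $n$-th root of unity in an extension field of $\mathbb F_q$. For an integer $\gamma$ let $f_\gamma(x)$ be the minimal polynomial of $\zeta_n^{\gamma}$ over $\mathbb F_q$. For integers $D\ge 2$ and $b$, put $f_{(q,n,D,b)}=\operatorname{lcm}(f_b,f_{b+1},\dots,f_{b+D-2})$ (monic), and let $\mathcal C_{(q,n,D,b)}$ be the cyclic code of length $n$ over $\mathbb F_q$ corresponding to the ideal generated by $f_{(q,n,D,b)}$ in $\mathbb F_q[x]/(x^n-1)$. Let $\delta$ be an integer with $\lambda\mid\delta$ and $$\lambda\le\delta\le\lambda q^{m/2}-1\ \ (m\text{ even}),\qquad \lambda\le\delta\le\lambda\bigl(q^{(m-1)/2}+q\bigr)-1\ \ (m\text{ odd}).$$ If $m=2$, assume moreover that either $q$ is even, or $q$ is odd and $\lambda\le\frac{q-1}{2}$; and if $m=2$, $q$ is even and $\lambda=q-1$, assume also $\delta<\frac{q(q+1)}{2}$. If $m=3$, assume moreover $\lambda\le\lceil\frac q2\rceil$; and if $m=3$ and $\lambda=\lceil\frac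 q2\rceil$, assume also $\delta\le q^2-q$. Then $\mathcal C_{(q,n,2\delta+1,n-\delta+1)}$, a linear code of length $n=\lambda(q^m+1)$, has dimension $$\lambda q^m-2m\Bigl(2\delta-\frac{\delta}{\lambda}-\Bigl\lfloor\frac{\delta-1}{q}\Bigr\rfloor-\Bigl\lfloor\frac{\delta}{q}\Bigr\rfloor+\Bigl\lfloor\frac{\delta-1}{\lambda q}\Bigr\rfloor\Bigr)+\lambda-1$$ and minimum distance $d\ge 2(\delta+1)$ (the minimum distance of the zero code being $\infty$). Its generator polynomial, i.e. the monic divisor of $x^n-1$ generating the corresponding ideal, is $$f_{(q,n,2\delta+1,n-\delta+1)}(x)=(x-1)\cdot\prod_{\substack{1\le\gamma\le\delta\\ q\nmid\gamma,\ \lambda\nmid\gamma}}f_\gamma(x)f_{-\gamma}(x)\cdot\prod_{\substack{1\le\gamma\le\delta\\ q\nmid\gamma,\ \lambda\mid\gamma}}f_\gamma(x).$$ -/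

import Mathlib

open Polynomial

noncomputable section

namespace BCH

variable {F : Type*} [Field F] {K : Type*} [Field K] [Algebra F K]

/-- The `F`-linear map sending a word `(c₀, …, c_{n-1})` to the class of
`c₀ + c₁ x + ⋯ + c_{n-1} x^{n-1}` in `F[x] / (x^n - 1)`. -/
def wordClass (F : Type*) [Field F] (n : ℕ) :
    (Fin n → F) →ₗ[F] F[X] ⧸ Ideal.span {(X ^ n - 1 : F[X])} where
  toFun c := Ideal.Quotient.mk _ (∑ i : Fin n, C (c i) * X ^ (i : ℕ))
  map_add' c d := by
    simp only [Pi.add_apply, map_add, add_mul, Finset.sum_add_distrib]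
  map_smul' a c := by
    rw [RingHom.id_apply, ← Ideal.Quotient.mkₐ_eq_mk F, ← map_smul, Finset.smul_sum]
    simp only [Pi.smul_apply, smul_eq_mul, C_mul, smul_eq_C_mul, mul_assoc]

/-- The cyclic code of length `n` generated by `g`: the words whose class lies in the ideal
`(g)` of `F[x] / (x^n - 1)`. -/
def cyclicCode (n : ℕ) (g : F[X]) : Submodule F (Fin n → F) :=
  (((Ideal.span {Ideal.Quotient.mk (Ideal.span {(X ^ n - 1 : F[X])}) g} :
    Ideal (F[X] ⧸ Ideal.span {(X ^ n - 1 : F[X])}))).restrictScalars F).comap (wordClass F n)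

/-- `g` is the generator polynomial of the linear code `𝒞` of length `n`: it is the monic divisor
of `x^n - 1` that generates the corresponding ideal. -/
def IsGeneratorPolynomial {n : ℕ} (𝒞 : Submodule F (Fin n → F)) (g : F[X]) : Prop :=
  g.Monic ∧ g ∣ X ^ n - 1 ∧ 𝒞 = cyclicCode n g

/-- `f_γ`, the minimal polynomial over `F` of `ζ^γ`, for an integer exponent `γ`. -/
def minPoly (F : Type*) [Field F] {K : Type*} [Field K] [Algebra F K] (ζ : K) (γ : ℤ) : F[X] :=
  minpoly F (ζ ^ γ)

open Classical in
/-- `lcm (f_b, f_{b+1}, …, f_{b+δ-2})`, the monic least common multiple. -/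
def bchPolynomial (F : Type*) [Field F] {K : Type*} [Field K] [Algebra F K]
    (ζ : K) (δ : ℕ) (b : ℤ) : F[X] :=
  letI : NormalizedGCDMonoid F[X] := UniqueFactorizationMonoid.toNormalizedGCDMonoid F[X]
  (Finset.Icc b (b + (δ : ℤ) - 2)).lcm (minPoly F ζ)

/-- The BCH code over `F` of length `n` and designed distance `δ`, starting at exponent `b`, with
respect to the primitive `n`-th root of unity `ζ`. -/
def bchCode (F : Type*) [Field F] {K : Type*} [Field K] [Algebra F K]
    (n : ℕ) (ζ : K) (δ : ℕ) (b : ℤ) : Submodule F (Fin n → F) :=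
  cyclicCode n (bchPolynomial F ζ δ b)

open Classical in
/-- Minimum Hamming distance between distinct codewords (`⊤` for the zero code). -/
def minDist {n : ℕ} (𝒞 : Submodule F (Fin n → F)) : ℕ∞ :=
  ⨅ (x ∈ 𝒞) (y ∈ 𝒞) (_ : x ≠ y), (hammingDist x y : ℕ∞)

end BCH

end

open Polynomial

noncomputable section

/-! ### Inequalities on exponents, and the case 0 < i < m. -/

namespace BCH

/-! Put N = q^m + 1, so that n = λN. As q^m ≡ -1 mod N and λ ∣ q - 1, we have q^(2m) ≡ 1 mod n. Over
F_q, f_a = f_b exactly when b ≡ a q^i mod n for some i, so everything rests on one rigidity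
statement, `SmallExponents.rigid`: if a and b are prime to q in the sense q ∤ a, q ∤ b, have
absolute value at most δ, and a q^i ≡ b mod n with 0 ≤ i < 2m, then either i = 0 and b = a, or i =
m, b = -a and λ ∣ a. For 0 < i < m this is a size argument (`not_dvd_mul_pow_sub`), for i = m it
reduces to N ∣ a + b, and i > m is reflected to 2m - i. The case distinctions on m, q and λ only
supply the inequalities needed here, collected in `SmallExponents`.

Hence f_γ has degree 2m for 0 < |γ| ≤ δ with q ∤ γ, and the only coincidences are f_γ = f_{-γ} for λ
∣ γ. Removing powers of q from an exponent does not change its minimal polynomial, so the lcm is the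
product over `cosetReps`. Its degree, found by inclusion-exclusion, gives the dimension.

Modulo n the defining exponents are -δ+1, …, δ. Since λ ∣ δ, also ζ^(-δ) is conjugate to ζ^δ, so
there are 2δ + 1 consecutive roots and the BCH bound yields 2δ + 2. -/

theorem even_exponent_bounds {q l d : ℤ} {h i : ℕ} (hq : 2 ≤ q) (hl : 1 ≤ l) (hlq : l ≤ q - 1)
    (hi : 1 ≤ i) (hih : i < 2 * h) (hd : d ≤ l * (q ^ h - 1)) :
    d * (q ^ i + 1) < l * (q ^ (2 * h) + 1) ∨ d * (q ^ (2 * h - i) + 1) < q ^ (2 * h) + 1 ∨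
      i = h := by
  have hq1 : 1 ≤ q := by linarith
  rcases lt_trichotomy i h with hlt | heq | hgt
  · left
    obtain ⟨k, rfl⟩ : ∃ k, h = k + 1 := ⟨h - 1, by omega⟩
    have h1 : q ^ i ≤ q ^ k := pow_le_pow_right₀ hq1 (by omega)
    have hx : 1 ≤ q ^ k := one_le_pow₀ hq1
    have e1 : q ^ (2 * (k + 1)) = (q ^ k) ^ 2 * q ^ 2 := by ring
    have e2 : q ^ (k + 1) = q ^ k * q := by ring
    rw [e1]; rw [e2] at hd
    generalize q ^ k = x at *
    have hp : 0 ≤ x * q - 1 := by nlinarith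
    calc d * (q ^ i + 1) ≤ l * (x * q - 1) * (x + 1) := by gcongr
      _ = l * ((x * q - 1) * (x + 1)) := by ring
      _ < l * (x ^ 2 * q ^ 2 + 1) := by
        apply mul_lt_mul_of_pos_left _ (by linarith)
        have : x * q * x * 2 ≤ x * q * x * q := by gcongr
        have : x * q * 1 ≤ x * q * x := by gcongr
        nlinarith
  · exact Or.inr (Or.inr heq)
  · right; left
    -- h < i < 2h forces h ≥ 2. With x = q ^ k the estimate becomes polynomial in x and q; the right
    -- side has no factor l, so l is bounded by q - 1.
    obtain ⟨k, rfl⟩ : ∃ k, h = k + 2 := ⟨h - 2, by omega⟩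
    have h1 : q ^ (2 * (k + 2) - i) ≤ q ^ (k + 1) := pow_le_pow_right₀ hq1 (by omega)
    have hx : 1 ≤ q ^ k := one_le_pow₀ hq1
    have e1 : q ^ (2 * (k + 2)) = (q ^ k) ^ 2 * q ^ 4 := by ring
    have e2 : q ^ (k + 2) = q ^ k * q ^ 2 := by ring
    have e3 : q ^ (k + 1) = q ^ k * q := by ring
    rw [e1]; rw [e2] at hd; rw [e3] at h1
    generalize q ^ k = x at *
    have hp : 0 ≤ x * q ^ 2 - 1 := by nlinarith
    calc d * (q ^ (2 * (k + 2) - i) + 1) ≤ (q - 1) * (x * q ^ 2 - 1) * (x * q + 1) := by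
          gcongr
          exact hd.trans (by gcongr)
      _ < x ^ 2 * q ^ 4 + 1 := by
        have h2 : x * q ^ 3 ≤ x ^ 2 * q ^ 3 := by gcongr; nlinarith
        have h3 : x * q * 2 ≤ x * q * q := by gcongr
        nlinarith

/-- For i ≤ h there is a spare factor q. For i > h the leading term (q - 1) q^(2h) leaves q^(2h) for
the rest, which suffices because q - 1 is of lower order than q^h when h ≥ 2. -/
theorem odd_exponent_bounds {q l d : ℤ} {h i : ℕ} (hq : 2 ≤ q) (hl : 1 ≤ l) (hlq : l ≤ q - 1)
    (hh : 2 ≤ h) (hd : d ≤ l * (q ^ h + q - 1)) (hi : i ≤ 2 * h) :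
    d * (q ^ i + 1) < l * (q ^ (2 * h + 1) + 1) ∨
      d * (q ^ (2 * h + 1 - i) + 1) < q ^ (2 * h + 1) + 1 := by
  have hq1 : 1 ≤ q := by linarith
  obtain ⟨k, rfl⟩ : ∃ k, h = k + 2 := ⟨h - 2, by omega⟩
  have hx : 1 ≤ q ^ k := one_le_pow₀ hq1
  have e1 : q ^ (2 * (k + 2) + 1) = (q ^ k) ^ 2 * q ^ 5 := by ring
  have e2 : q ^ (k + 2) = q ^ k * q ^ 2 := by ring
  have hcube : q ^ 2 * 2 ≤ q ^ 2 * q := by gcongr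
  rcases le_or_gt i (k + 2) with hik | hik
  · left
    have h1 : q ^ i ≤ q ^ (k + 2) := pow_le_pow_right₀ hq1 hik
    rw [e1]; rw [e2] at hd h1
    generalize q ^ k = x at *
    have hp : 0 ≤ x * q ^ 2 + q - 1 := by nlinarith
    calc d * (q ^ i + 1) ≤ l * (x * q ^ 2 + q - 1) * (x * q ^ 2 + 1) := by gcongr
      _ = l * ((x * q ^ 2 + q - 1) * (x * q ^ 2 + 1)) := by ring
      _ < l * (x ^ 2 * q ^ 5 + 1) := by
        apply mul_lt_mul_of_pos_left _ (by linarith)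
        have h2 : x ^ 2 * q ^ 4 * 2 ≤ x ^ 2 * q ^ 4 * q := by gcongr
        have h3 : 1 * x * q ^ 3 * 2 ≤ x * x * q ^ 3 * q := by gcongr
        have h4 : 1 * q ^ 3 ≤ x * q ^ 3 := by gcongr
        nlinarith
  · right
    have h1 : q ^ (2 * (k + 2) + 1 - i) ≤ q ^ (k + 2) := pow_le_pow_right₀ hq1 (by omega)
    rw [e1]; rw [e2] at hd h1
    generalize q ^ k = x at *
    have hp : 0 ≤ x * q ^ 2 + q - 1 := by nlinarith
    calc d * (q ^ (2 * (k + 2) + 1 - i) + 1)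
        ≤ (q - 1) * (x * q ^ 2 + q - 1) * (x * q ^ 2 + 1) := by
          gcongr
          exact hd.trans (by gcongr)
      _ < x ^ 2 * q ^ 5 + 1 := by
        have h3 : 1 * x * q ^ 4 ≤ x * x * q ^ 4 := by gcongr
        have h4 : 1 * q ^ 3 ≤ x * q ^ 3 := by gcongr
        nlinarith

/-- No `q`-power multiple with exponent strictly between `0` and `m` links two residues
modulo `l (q ^ m + 1)` that are small and prime to `q`. -/
theorem not_dvd_mul_pow_sub {q l d a b : ℤ} {m i : ℕ} (hq : 2 ≤ q) (hl : 1 ≤ l)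
    (hi : 1 ≤ i) (him : i < m) (ha : |a| ≤ d) (hb : |b| ≤ d) (hqa : ¬ q ∣ a) (hqb : ¬ q ∣ b)
    (H : d * (q ^ i + 1) < l * (q ^ m + 1) ∨ d * (q ^ (m - i) + 1) < q ^ m + 1 ∨
      (m = 2 * i ∧ d ≤ l * (q ^ i - 1))) :
    ¬ l * (q ^ m + 1) ∣ a * q ^ i - b := by
  rintro ⟨k, hk⟩
  obtain ⟨j, rfl⟩ : ∃ j, m = i + j := ⟨m - i, by omega⟩
  rw [Nat.add_sub_cancel_left] at H
  have hq0 : (0 : ℤ) < q := by linarith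
  have hx : 0 < q ^ i := by positivity
  have hy : 0 < q ^ j := by positivity
  have hk0 : k ≠ 0 := by
    rintro rfl
    apply hqb
    rw [show b = a * q ^ i by linarith]
    exact (dvd_pow_self q (by omega)).mul_left _
  have hd0 : 0 ≤ d := (abs_nonneg a).trans ha
  rw [pow_add] at hk H
  -- t is the companion quotient: t (q^m + 1) = b q^j + a, while l k (q^m + 1) = a q^i - b. Since k
  -- and t are nonzero, the first two alternatives of `H` contradict these identities by size.
  obtain ⟨t, ht⟩ : ∃ t, t = a - l * k * q ^ j := ⟨_, rfl⟩
  have ht0 : t ≠ 0 := by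
    rintro rfl
    apply hqa
    rw [show a = l * k * q ^ j by linarith]
    exact (dvd_pow_self q (by omega)).mul_left _
  have hta : a = l * k * q ^ j + t := by linarith
  have htb : b = t * q ^ i - l * k := by
    have : a * q ^ i = (l * k * q ^ j + t) * q ^ i := by rw [← hta]
    nlinarith
  have hs : (l * k) * (q ^ i * q ^ j + 1) = a * q ^ i - b := by rw [hk]; ring
  have ht' : t * (q ^ i * q ^ j + 1) = b * q ^ j + a := by rw [htb, hta]; ring
  have hk1 : 1 ≤ |k| := Int.one_le_abs hk0
  have ht1 : 1 ≤ |t| := Int.one_le_abs ht0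
  have hN : 0 < q ^ i * q ^ j + 1 := by positivity
  have bs : |k| * (l * (q ^ i * q ^ j + 1)) ≤ d * (q ^ i + 1) := by
    calc |k| * (l * (q ^ i * q ^ j + 1)) = |(l * k) * (q ^ i * q ^ j + 1)| := by
          rw [abs_mul, abs_mul, abs_of_pos hN, abs_of_pos (show 0 < l by linarith)]; ring
      _ = |a * q ^ i - b| := by rw [hs]
      _ ≤ |a * q ^ i| + |b| := abs_sub _ _
      _ = |a| * q ^ i + |b| := by rw [abs_mul, abs_of_pos hx]
      _ ≤ d * q ^ i + d := by gcongr
      _ = d * (q ^ i + 1) := by ring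
  have bt : |t| * (q ^ i * q ^ j + 1) ≤ d * (q ^ j + 1) := by
    calc |t| * (q ^ i * q ^ j + 1) = |t * (q ^ i * q ^ j + 1)| := by
          rw [abs_mul, abs_of_pos hN]
      _ = |b * q ^ j + a| := by rw [ht']
      _ ≤ |b * q ^ j| + |a| := abs_add_le _ _
      _ = |b| * q ^ j + |a| := by rw [abs_mul, abs_of_pos hy]
      _ ≤ d * q ^ j + d := by gcongr
      _ = d * (q ^ j + 1) := by ring
  have hlN : 0 < l * (q ^ i * q ^ j + 1) := by positivity
  rcases H with H | H | ⟨hij, H⟩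
  · nlinarith
  · nlinarith
  · obtain rfl : j = i := by omega
    generalize q ^ j = x at *
    have hk2 : |k| < 2 := by
      by_contra! hc
      have h1 : 2 * (l * (x * x + 1)) ≤ l * (x - 1) * (x + 1) :=
        le_trans (by gcongr) (bs.trans (by gcongr))
      nlinarith
    rw [abs_le] at ha hb
    have hke : |k| = 1 := by omega
    -- As a = l k x + t and |a| ≤ l (x - 1), t has sign opposite to k and |t| ≥ l; then b = t x - l
    -- k satisfies |b| ≥ l (x + 1) > d.
    rcases (abs_eq (zero_le_one' ℤ)).1 hke with rfl | rfl
    · have : t ≤ -l := by linarith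
      nlinarith
    · have : l ≤ t := by linarith
      nlinarith

end BCH

/-! ### Rigidity of small exponents, and the ranges of parameters that ensure it. -/

namespace BCH

/-- Size conditions on `d` which make the exponents of absolute value at most `d` behave like
independent cyclotomic coset representatives modulo `l (q ^ m + 1)`. -/
structure SmallExponents (q l d : ℤ) (m : ℕ) : Prop where
  two_le : 2 ≤ q
  one_le : 1 ≤ l
  dvd_pred : l ∣ q - 1
  dvd : l ∣ d
  two_mul_lt : 2 * d < l * (q ^ m + 1)
  middle : ∀ i, 1 ≤ i → i < m → d * (q ^ i + 1) < l * (q ^ m + 1) ∨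
    d * (q ^ (m - i) + 1) < q ^ m + 1 ∨ (m = 2 * i ∧ d ≤ l * (q ^ i - 1))
  half : 2 * d < q ^ m + 1 ∨ (m = 2 ∧ l = q - 1 ∧ Even q ∧ 2 * d < q ^ 2 + q)

/-- With q = 2k, equality would give a = 1 + (q - 1) j and b = 1 + (q - 1)(q + 1 - j). If d = (q -
1) e, then j < e and q + 1 - j < e force e ≥ k + 2, whereas 2d < q^2 + q gives e ≤ k + 1. This
serves m = 2, l = q - 1, q even, where 2d may exceed q^2 + 1. -/
theorem add_ne_sq_add_one {k d a b : ℤ} (hk : 1 ≤ k) (hd : 2 * k - 1 ∣ d)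
    (hd2 : 2 * d < (2 * k) ^ 2 + 2 * k) (ha : a ≤ d) (hb : b ≤ d)
    (hab : 2 * k - 1 ∣ a - b) : a + b ≠ (2 * k) ^ 2 + 1 := by
  intro h
  obtain ⟨e, rfl⟩ := hd
  obtain ⟨f, hf⟩ := hab
  have h1 : e < k + 2 := by nlinarith
  -- `2 (a - 1) = (2 k - 1) (f + 2 k + 1)`, so `f` is odd
  have h2 : 2 * (a - 1) = (2 * k - 1) * (f + 2 * k + 1) := by linarith
  have h3 : Even (f + 2 * k + 1) := by
    have : Even ((2 * k - 1) * (f + 2 * k + 1)) := by rw [← h2]; exact even_two_mul _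
    rcases Int.even_mul.1 this with h | h
    · exact absurd h (by rw [Int.not_even_iff_odd]; exact ⟨k - 1, by ring⟩)
    · exact h
  obtain ⟨j, hj⟩ := h3
  have h4 : a = 1 + (2 * k - 1) * j := by
    have : 2 * (a - 1) = 2 * ((2 * k - 1) * j) := by rw [h2, hj]; ring
    linarith
  have h5 : b = 1 + (2 * k - 1) * (2 * k + 1 - j) := by linarith
  have h6 : j < e := by nlinarith
  have h7 : 2 * k + 1 - j < e := by nlinarith
  have h8 : e = k + 1 ∨ e ≤ k := by omega
  omega

/-- Modulo q^m + 1 the hypothesis says a + b ≡ 0, and |a + b| ≤ 2d leaves only a + b = 0, except in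
the second alternative of `half`, where ±(q^2 + 1) must also be excluded. -/
theorem SmallExponents.eq_neg_of_dvd {q l d : ℤ} {m : ℕ} (h : SmallExponents q l d m) {a b : ℤ}
    (ha : |a| ≤ d) (hb : |b| ≤ d) (hab : l * (q ^ m + 1) ∣ a * q ^ m - b) :
    b = -a ∧ l ∣ a := by
  have hq0 : 0 < q := by linarith [h.two_le]
  have hN : 0 < q ^ m + 1 := by positivity
  have hsum : q ^ m + 1 ∣ a + b := by
    have h1 : q ^ m + 1 ∣ a * q ^ m - b := (dvd_mul_left _ _).trans hab
    have h2 : a + b = a * (q ^ m + 1) - (a * q ^ m - b) := by ring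
    rw [h2]
    exact dvd_sub (dvd_mul_left _ _) h1
  have hle : |a + b| ≤ 2 * d := (abs_add_le a b).trans (by linarith)
  have hzero : a + b = 0 := by
    rcases h.half with h1 | ⟨rfl, rfl, ⟨k, rfl⟩, h1⟩
    · exact Int.eq_zero_of_abs_lt_dvd hsum (by linarith)
    · rw [← two_mul] at *
      have hk : 1 ≤ k := by omega
      obtain ⟨c, hc⟩ := hsum
      have hab' : 2 * k - 1 ∣ a - b := by
        have h2 : 2 * k - 1 ∣ a * (2 * k) ^ 2 - b := (dvd_mul_right _ _).trans hab
        have h3 : a - b = (a * (2 * k) ^ 2 - b) - (2 * k - 1) * (a * (2 * k + 1)) := by ring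
        rw [h3]
        exact dvd_sub h2 (dvd_mul_right _ _)
      have hc2 : |c| < 2 := by
        rw [hc, abs_mul, abs_of_pos hN] at hle
        nlinarith
      rw [abs_lt] at hc2
      rw [abs_le] at ha hb
      obtain rfl | rfl | rfl : c = -1 ∨ c = 0 ∨ c = 1 := by omega
      · refine absurd (show -a + -b = (2 * k) ^ 2 + 1 by linarith)
          (add_ne_sq_add_one hk h.dvd h1 (by linarith) (by linarith) ?_)
        rw [show -a - -b = -(a - b) by ring]
        exact (dvd_neg).2 hab'
      · linarith
      · exact absurd (show a + b = (2 * k) ^ 2 + 1 by linarith)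
          (add_ne_sq_add_one hk h.dvd h1 (by linarith) (by linarith) hab')
  obtain rfl : b = -a := by linarith
  refine ⟨rfl, ?_⟩
  rw [show a * q ^ m - -a = a * (q ^ m + 1) by ring] at hab
  exact Int.dvd_of_mul_dvd_mul_right hN.ne' hab

theorem SmallExponents.rigid {q l d : ℤ} {m : ℕ} (h : SmallExponents q l d m) {a b : ℤ} {i : ℕ}
    (ha : |a| ≤ d) (hb : |b| ≤ d) (hqa : ¬ q ∣ a) (hqb : ¬ q ∣ b) (hi : i < 2 * m)
    (hab : l * (q ^ m + 1) ∣ a * q ^ i - b) :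
    (i = 0 ∧ a = b) ∨ (i = m ∧ b = -a ∧ l ∣ a) := by
  rcases Nat.eq_zero_or_pos i with rfl | hi0
  · left
    refine ⟨rfl, sub_eq_zero.1 ?_⟩
    rw [pow_zero, mul_one] at hab
    refine Int.eq_zero_of_abs_lt_dvd hab ?_
    linarith [abs_sub a b, h.two_mul_lt]
  rcases lt_trichotomy i m with hlt | rfl | hgt
  · exact absurd hab (not_dvd_mul_pow_sub h.two_le h.one_le hi0 hlt ha hb hqa hqb
      (h.middle i hi0 hlt))
  · exact Or.inr ⟨rfl, h.eq_neg_of_dvd ha hb hab⟩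
  -- Since q^(2m) ≡ 1 mod n, multiplying by q^(2m - i) exchanges a and b and replaces i by 2m - i <
  -- m.
  · exfalso
    have hj : 1 ≤ 2 * m - i := by omega
    have hjm : 2 * m - i < m := by omega
    refine not_dvd_mul_pow_sub h.two_le h.one_le hj hjm hb ha hqb hqa (h.middle _ hj hjm) ?_
    obtain ⟨c, hc⟩ : l ∣ q ^ m - 1 := h.dvd_pred.trans (by simpa using sub_dvd_pow_sub_pow q 1 m)
    have h1 : q ^ i * q ^ (2 * m - i) = q ^ m * q ^ m := by
      rw [← pow_add, ← pow_add]; congr 1; omega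
    have h2 : b * q ^ (2 * m - i) - a
        = l * (q ^ m + 1) * (a * c) - (a * q ^ i - b) * q ^ (2 * m - i) := by
      have : l * (q ^ m + 1) * (a * c) = a * (q ^ m * q ^ m - 1) := by
        rw [show l * (q ^ m + 1) * (a * c) = a * ((l * c) * (q ^ m + 1)) by ring, ← hc]; ring
      rw [this, ← h1]; ring
    rw [h2]
    exact dvd_sub (dvd_mul_right _ _) (hab.mul_right _)

theorem smallExponents_even {q l d : ℤ} {h : ℕ} (hq : 2 ≤ q) (hl : 1 ≤ l) (hlq : l ∣ q - 1)
    (hld : l ∣ d) (hd0 : 0 ≤ d) (hh : 1 ≤ h) (hd : d ≤ l * q ^ h - 1)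
    (h2 : h = 1 → 2 * l ≤ q - 1 ∨ (l = q - 1 ∧ Even q ∧ 2 * d < q ^ 2 + q)) :
    SmallExponents q l d (2 * h) := by
  have hl1 : l ≤ q - 1 := Int.le_of_dvd (by linarith) hlq
  -- Because l ∣ d, the bound l q^h - 1 drops to the next multiple of l.
  have hd' : d ≤ l * (q ^ h - 1) := by
    obtain ⟨e, rfl⟩ := hld
    have : e < q ^ h := by nlinarith
    have : e ≤ q ^ h - 1 := by omega
    gcongr
  have hqh : 1 ≤ q ^ h := one_le_pow₀ (by linarith)
  have e : q ^ (2 * h) = q ^ h * q ^ h := by rw [two_mul, pow_add]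
  refine ⟨hq, hl, hlq, hld, ?_, ?_, ?_⟩
  · rw [e]
    generalize q ^ h = x at *
    nlinarith [mul_nonneg (show 0 ≤ l by linarith) (sq_nonneg (x - 1))]
  · intro i hi him
    rcases even_exponent_bounds hq hl hl1 hi him hd' with H | H | rfl
    · exact Or.inl H
    · exact Or.inr (Or.inl H)
    · exact Or.inr (Or.inr ⟨rfl, hd'⟩)
  · rcases Nat.lt_or_ge 1 h with h1 | h1
    · left
      obtain ⟨k, rfl⟩ : ∃ k, h = k + 2 := ⟨h - 2, by omega⟩
      have hx : 1 ≤ q ^ k := one_le_pow₀ (by linarith)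
      rw [e]
      rw [show q ^ (k + 2) = q ^ k * q ^ 2 by ring] at *
      generalize q ^ k = x at *
      have h3 : d ≤ (q - 1) * (x * q ^ 2 - 1) := hd'.trans (by gcongr)
      have h4 : 1 * x * q ^ 3 * 2 ≤ x * x * q ^ 3 * q := by gcongr
      nlinarith
    · obtain rfl : h = 1 := by omega
      rcases h2 rfl with h3 | ⟨h3, h4, h5⟩
      · left
        norm_num at hd' ⊢
        nlinarith
      · exact Or.inr ⟨by norm_num, h3, h4, h5⟩

theorem smallExponents_odd {q l d : ℤ} {h : ℕ} (hq : 2 ≤ q) (hl : 1 ≤ l) (hlq : l ∣ q - 1)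
    (hld : l ∣ d) (hd0 : 0 ≤ d) (hh : 1 ≤ h) (hd : d ≤ l * (q ^ h + q) - 1)
    (h3 : h = 1 → 2 * l ≤ q - 1 ∨ (q = 2 ∧ l = 1 ∧ d ≤ 2) ∨ (q = 3 ∧ l = 2 ∧ d ≤ 6)) :
    SmallExponents q l d (2 * h + 1) := by
  have hl1 : l ≤ q - 1 := Int.le_of_dvd (by linarith) hlq
  have hd' : d ≤ l * (q ^ h + q - 1) := by
    obtain ⟨e, rfl⟩ := hld
    have : e < q ^ h + q := by nlinarith
    have : e ≤ q ^ h + q - 1 := by omega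
    gcongr
  rcases Nat.lt_or_ge 1 h with h1 | h1
  · have hhalf : 2 * d < q ^ (2 * h + 1) + 1 := by
      obtain ⟨k, rfl⟩ : ∃ k, h = k + 2 := ⟨h - 2, by omega⟩
      have hx : 1 ≤ q ^ k := one_le_pow₀ (by linarith)
      rw [show q ^ (2 * (k + 2) + 1) = q ^ k * q ^ k * q ^ 5 by ring]
      rw [show q ^ (k + 2) = q ^ k * q ^ 2 by ring] at *
      generalize q ^ k = x at *
      have h3 : d ≤ (q - 1) * (x * q ^ 2 + q - 1) := hd'.trans (by gcongr; nlinarith)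
      have h4 : 1 * x * q ^ 3 * 2 ^ 2 ≤ x * x * q ^ 3 * q ^ 2 := by gcongr
      have h5 : 1 * q ^ 2 ≤ x * q ^ 2 := by gcongr
      have h6 : x * q ^ 2 * 2 ≤ x * q ^ 2 * q := by gcongr
      nlinarith
    refine ⟨hq, hl, hlq, hld, ?_, ?_, Or.inl hhalf⟩
    · have : 0 ≤ q ^ (2 * h + 1) + 1 := by positivity
      nlinarith
    · intro i hi him
      rcases odd_exponent_bounds (i := i) hq hl hl1 h1 hd' (by omega) with H | H
      · exact Or.inl H
      · exact Or.inr (Or.inl H)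
  · obtain rfl : h = 1 := by omega
    norm_num at hd' ⊢
    rcases h3 rfl with h2 | ⟨rfl, rfl, h2⟩ | ⟨rfl, rfl, h2⟩
    · have hq3 : 3 ≤ q := by linarith
      have hd2 : 2 * d ≤ (q - 1) * (q + q - 1) := by nlinarith
      have hc : q ^ 2 * 3 ≤ q ^ 2 * q := by gcongr
      have hhalf : 2 * d < q ^ 3 + 1 := by nlinarith
      refine ⟨hq, hl, hlq, hld, by nlinarith, ?_, Or.inl hhalf⟩
      intro i hi him
      interval_cases i
      · left
        calc d * (q ^ 1 + 1) ≤ l * (q + q - 1) * (q ^ 1 + 1) := by gcongr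
          _ < l * (q ^ 3 + 1) := by
            rw [mul_assoc]
            apply mul_lt_mul_of_pos_left _ (by linarith)
            nlinarith
      · right; left
        norm_num
        nlinarith
    · refine ⟨by norm_num, by norm_num, by norm_num, hld, by linarith, ?_, Or.inl (by linarith)⟩
      intro i hi him
      interval_cases i
      · left; linarith
      · right; left; norm_num; linarith
    · refine ⟨by norm_num, by norm_num, by norm_num, hld, by linarith, ?_, Or.inl (by linarith)⟩
      intro i hi him
      interval_cases i
      · left; linarith
      · right; left; norm_num; linarith

theorem smallExponents_of_bounds (q m lam δ : ℕ) (hq : 2 ≤ q)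
    (hm : 2 ≤ m)
    (hlam : lam ∣ q - 1)
    (hδ : lam ∣ δ)
    (hδ_even : Even m → δ ≤ lam * q ^ (m / 2) - 1)
    (hδ_odd : Odd m → δ ≤ lam * (q ^ ((m - 1) / 2) + q) - 1)
    (hm2 : m = 2 → Even q ∨ (Odd q ∧ lam ≤ (q - 1) / 2))
    (hm2' : m = 2 → Even q → lam = q - 1 → 2 * δ < q * (q + 1))
    (hm3 : m = 3 → lam ≤ (q + 1) / 2)
    (hm3' : m = 3 → lam = (q + 1) / 2 → δ ≤ q ^ 2 - q) :
    SmallExponents q lam δ m := by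
  have hl : 1 ≤ lam := Nat.pos_of_dvd_of_pos hlam (by omega)
  have hlq : (lam : ℤ) ∣ q - 1 := by
    have := Int.natCast_dvd_natCast.2 hlam
    rwa [Nat.cast_sub (by omega), Nat.cast_one] at this
  -- A proper divisor of q - 1 is at most half of it, so only λ = q - 1 is delicate.
  have hhalf : lam = q - 1 ∨ 2 * lam ≤ q - 1 := by
    obtain ⟨c, hc⟩ := hlam
    rcases Nat.lt_or_ge c 2 with h | h
    · interval_cases c <;> omega
    · right; rw [hc]; nlinarith
  rcases Nat.even_or_odd' m with ⟨h, rfl | rfl⟩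
  · have h1 := hδ_even (even_two_mul h)
    rw [Nat.mul_div_cancel_left _ two_pos] at h1
    have hp : 1 ≤ lam * q ^ h := Nat.mul_pos hl (by positivity)
    refine smallExponents_even (by exact_mod_cast hq) (by exact_mod_cast hl) hlq
      (by exact_mod_cast hδ) (by positivity) (by omega) ?_ ?_
    · zify [hp] at h1; exact h1
    · rintro rfl
      rcases hhalf with h2 | h2
      · rcases hm2 rfl with he | ⟨-, ho⟩
        · right
          refine ⟨by omega, by exact_mod_cast he, ?_⟩
          have := hm2' rfl he h2
          zify at this
          linarith
        · left; omega
      · left; omega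
  · have h1 := hδ_odd ⟨h, rfl⟩
    rw [Nat.add_sub_cancel, Nat.mul_div_cancel_left _ two_pos] at h1
    have hp : 1 ≤ lam * (q ^ h + q) := Nat.mul_pos hl (by positivity)
    refine smallExponents_odd (by exact_mod_cast hq) (by exact_mod_cast hl) hlq
      (by exact_mod_cast hδ) (by positivity) (by omega) ?_ ?_
    · zify [hp] at h1; exact h1
    · rintro rfl
      rcases hhalf with h2 | h2
      -- λ = q - 1 ≤ ⌈q/2⌉ leaves q = 2 and q = 3; in both λ = ⌈q/2⌉, so δ ≤ q^2 - q is available.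
      · have h3 := hm3 rfl
        have hq3 : q ≤ 3 := by omega
        right
        interval_cases q
        · have := hm3' rfl (by omega)
          left; omega
        · have := hm3' rfl (by omega)
          right; omega
      · left; omega

end BCH

/-! ### Minimal polynomials over a finite field and Frobenius orbits of exponents. -/

namespace BCH

variable {F : Type*} [Field F] {K : Type*} [Field K] [Algebra F K]

section FiniteField

variable [Fintype F]

theorem minpoly_pow_card (β : K) (i : ℕ) :
    minpoly F (β ^ Fintype.card F ^ i) = minpoly F β := by
  induction i with
  | zero => rw [pow_zero, pow_one]
  | succ i ih =>
    rw [pow_succ, pow_mul, ← ih]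
    exact minpoly.algHom_eq (FiniteField.frobeniusAlgHom F K) (RingHom.injective _) _

/-- α and β generate a finite field, where conjugate elements differ by an automorphism, and every
automorphism is a power of Frobenius. -/
theorem exists_pow_card_of_minpoly_eq {α β : K} (hα : IsIntegral F α) (hβ : IsIntegral F β)
    (h : minpoly F α = minpoly F β) : ∃ i : ℕ, β = α ^ Fintype.card F ^ i := by
  let L := IntermediateField.adjoin F ({α, β} : Set K)
  have : FiniteDimensional F L := IntermediateField.finiteDimensional_adjoin (by
    rintro x (rfl | rfl)
    · exact hα
    · exact hβ)
  have : Finite L := Module.finite_of_finite F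
  let a : L := ⟨α, IntermediateField.subset_adjoin _ _ (by simp)⟩
  let b : L := ⟨β, IntermediateField.subset_adjoin _ _ (by simp)⟩
  have hconj : IsConjRoot F b a := by
    have h1 := minpoly.algebraMap_eq (A := F) (algebraMap L K).injective a
    have h2 := minpoly.algebraMap_eq (A := F) (algebraMap L K).injective b
    exact h2.symm.trans (h.symm.trans h1)
  obtain ⟨σ, hσ⟩ := isConjRoot_iff_exists_algEquiv.1 hconj
  obtain ⟨i, rfl⟩ := (FiniteField.bijective_frobeniusAlgEquivOfAlgebraic_pow F L).2 σ
  refine ⟨i, ?_⟩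
  simp only [AlgEquiv.coe_pow, FiniteField.coe_frobeniusAlgEquivOfAlgebraic_iterate] at hσ
  exact (congrArg (algebraMap L K) hσ).symm

/-- The degree is [F(β) : F], the order of Frobenius on F(β), and a power of Frobenius is trivial
there as soon as it fixes β. -/
theorem natDegree_minpoly_eq {β : K} (hβ : IsIntegral F β) {N : ℕ} (hN : 0 < N)
    (h : β ^ Fintype.card F ^ N = β)
    (hmin : ∀ i, 0 < i → i < N → β ^ Fintype.card F ^ i ≠ β) :
    (minpoly F β).natDegree = N := by
  let L := IntermediateField.adjoin F ({β} : Set K)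
  have : FiniteDimensional F L := IntermediateField.adjoin.finiteDimensional hβ
  have : Finite L := Module.finite_of_finite F
  let φ : L →ₐ[F] L := FiniteField.frobeniusAlgHom F L
  have hφ : ∀ (i : ℕ) (x : L), (φ ^ i) x = x ^ Fintype.card F ^ i := fun i x ↦ by
    rw [AlgHom.coe_pow, FiniteField.coe_frobeniusAlgHom, pow_iterate]
  have hpow : ∀ i : ℕ, φ ^ i = 1 ↔ β ^ Fintype.card F ^ i = β := fun i ↦ by
    constructor
    · intro hi
      have := DFunLike.congr_fun hi (IntermediateField.AdjoinSimple.gen F β)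
      rw [hφ] at this
      exact congrArg (algebraMap L K) this
    · intro hi
      refine IntermediateField.algHom_ext_of_eq_adjoin _ rfl fun x hx ↦ ?_
      obtain rfl : x = β := hx
      rw [hφ]
      exact Subtype.ext hi
  rw [← IntermediateField.adjoin.finrank hβ, ← FiniteField.orderOf_frobeniusAlgHom F L]
  exact (orderOf_eq_iff hN).2 ⟨(hpow N).2 h, fun i hi hi0 ↦ (hpow i).not.2 (hmin i hi0 hi)⟩

end FiniteField

variable {n : ℕ} {ζ : K}

theorem isIntegral_zpow_of_isPrimitiveRoot (hζ : IsPrimitiveRoot ζ n) (hn : 0 < n) (a : ℤ) :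
    IsIntegral F (ζ ^ a) := by
  refine IsIntegral.of_pow hn ?_
  rw [← zpow_natCast, ← zpow_mul, mul_comm, zpow_mul, zpow_natCast, hζ.pow_eq_one, one_zpow]
  exact isIntegral_one

theorem zpow_eq_zpow_iff_dvd (hζ : IsPrimitiveRoot ζ n) (hn : 0 < n) (a b : ℤ) :
    ζ ^ a = ζ ^ b ↔ (n : ℤ) ∣ a - b := by
  have h0 := hζ.ne_zero hn.ne'
  rw [← hζ.zpow_eq_one_iff_dvd, zpow_sub₀ h0, div_eq_one_iff_eq (zpow_ne_zero _ h0)]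

theorem zpow_pow_card (a : ℤ) (q i : ℕ) : (ζ ^ a) ^ q ^ i = ζ ^ (a * (q : ℤ) ^ i) := by
  rw [← zpow_natCast, ← zpow_mul]; norm_cast

section FiniteField

variable [Fintype F] {q : ℕ}

theorem minPoly_eq_of_dvd (hq : Fintype.card F = q) (hζ : IsPrimitiveRoot ζ n) (hn : 0 < n)
    {a b : ℤ} {i : ℕ} (h : (n : ℤ) ∣ a * (q : ℤ) ^ i - b) : minPoly F ζ a = minPoly F ζ b := by
  unfold minPoly
  rw [← (zpow_eq_zpow_iff_dvd hζ hn _ _).2 h, ← zpow_pow_card, ← hq, minpoly_pow_card]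

theorem exists_dvd_of_minPoly_eq (hq : Fintype.card F = q) (hζ : IsPrimitiveRoot ζ n) (hn : 0 < n)
    {r : ℕ} (hr : 0 < r) (hnr : (n : ℤ) ∣ (q : ℤ) ^ r - 1)
    {a b : ℤ} (h : minPoly F ζ a = minPoly F ζ b) :
    ∃ i < r, (n : ℤ) ∣ a * (q : ℤ) ^ i - b := by
  obtain ⟨i, hi⟩ := exists_pow_card_of_minpoly_eq (isIntegral_zpow_of_isPrimitiveRoot hζ hn a)
    (isIntegral_zpow_of_isPrimitiveRoot hζ hn b) h
  rw [hq, zpow_pow_card] at hi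
  refine ⟨i % r, Nat.mod_lt _ hr, ?_⟩
  have h1 := (zpow_eq_zpow_iff_dvd hζ hn _ _).1 hi.symm
  have h2 : (n : ℤ) ∣ (q : ℤ) ^ i - (q : ℤ) ^ (i % r) := by
    have h3 : (q : ℤ) ^ i - (q : ℤ) ^ (i % r) = (q : ℤ) ^ (i % r) * (((q : ℤ) ^ r) ^ (i / r) - 1) := by
      rw [mul_sub, ← pow_mul, ← pow_add, Nat.mod_add_div, mul_one]
    rw [h3]
    refine (hnr.trans ?_).mul_left _
    simpa using sub_dvd_pow_sub_pow ((q : ℤ) ^ r) 1 (i / r)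
  have h4 : a * (q : ℤ) ^ (i % r) - b = (a * (q : ℤ) ^ i - b) - a * ((q : ℤ) ^ i - (q : ℤ) ^ (i % r)) := by
    ring
  rw [h4]
  exact dvd_sub h1 (h2.mul_left _)

theorem natDegree_minPoly (hq : Fintype.card F = q) (hζ : IsPrimitiveRoot ζ n) (hn : 0 < n)
    {r : ℕ} (hr : 0 < r) (hnr : (n : ℤ) ∣ (q : ℤ) ^ r - 1) {a : ℤ}
    (h : ∀ i, 0 < i → i < r → ¬ (n : ℤ) ∣ a * (q : ℤ) ^ i - a) :
    (minPoly F ζ a).natDegree = r := by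
  subst hq
  refine natDegree_minpoly_eq (isIntegral_zpow_of_isPrimitiveRoot hζ hn a) hr ?_ ?_
  · rw [zpow_pow_card, zpow_eq_zpow_iff_dvd hζ hn, ← mul_sub_one]
    exact hnr.mul_left _
  · intro i hi hir
    rw [zpow_pow_card, Ne, zpow_eq_zpow_iff_dvd hζ hn]
    exact h i hi hir

end FiniteField

theorem minPoly_monic (hζ : IsPrimitiveRoot ζ n) (hn : 0 < n) (a : ℤ) : (minPoly F ζ a).Monic :=
  minpoly.monic (isIntegral_zpow_of_isPrimitiveRoot hζ hn a)

theorem minPoly_irreducible (hζ : IsPrimitiveRoot ζ n) (hn : 0 < n) (a : ℤ) :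
    Irreducible (minPoly F ζ a) :=
  minpoly.irreducible (isIntegral_zpow_of_isPrimitiveRoot hζ hn a)

theorem minPoly_dvd_X_pow_sub_one (hζ : IsPrimitiveRoot ζ n) (a : ℤ) :
    minPoly F ζ a ∣ X ^ n - 1 := by
  refine minpoly.dvd _ _ ?_
  rw [map_sub, map_pow, aeval_X, map_one, ← zpow_natCast, ← zpow_mul, mul_comm, zpow_mul,
    zpow_natCast, hζ.pow_eq_one, one_zpow, sub_self]

theorem bchPolynomial_dvd_iff (ζ : K) (D : ℕ) (b : ℤ) (p : F[X]) :
    bchPolynomial F ζ D b ∣ p ↔ ∀ a ∈ Finset.Icc b (b + (D : ℤ) - 2), minPoly F ζ a ∣ p := by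
  classical
  let : NormalizedGCDMonoid F[X] := UniqueFactorizationMonoid.toNormalizedGCDMonoid F[X]
  exact Finset.lcm_dvd_iff

theorem bchPolynomial_eq_of_monic {ζ : K} {D : ℕ} {b : ℤ} {p : F[X]} (hp : p.Monic)
    (h1 : bchPolynomial F ζ D b ∣ p) (h2 : p ∣ bchPolynomial F ζ D b) :
    bchPolynomial F ζ D b = p := by
  classical
  let : NormalizedGCDMonoid F[X] := UniqueFactorizationMonoid.toNormalizedGCDMonoid F[X]
  exact dvd_antisymm_of_normalize_eq Finset.normalize_lcm hp.normalize_eq_self h1 h2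

end BCH

/-! ### Cyclic codes: dimension and the BCH bound. -/

namespace BCH

variable {F : Type*} [Field F] {K : Type*} [Field K] [Algebra F K]

/-- The polynomial `c₀ + c₁ x + ⋯ + c_{n-1} x^{n-1}` of a word. -/
def wordPolynomial (F : Type*) [Field F] (n : ℕ) : (Fin n → F) →ₗ[F] F[X] where
  toFun c := ∑ i : Fin n, C (c i) * X ^ (i : ℕ)
  map_add' c d := by simp only [Pi.add_apply, map_add, add_mul, Finset.sum_add_distrib]
  map_smul' a c := by
    simp only [Pi.smul_apply, smul_eq_mul, C_mul, Finset.smul_sum, smul_eq_C_mul, mul_assoc,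
      RingHom.id_apply]

theorem wordPolynomial_apply {n : ℕ} (c : Fin n → F) :
    wordPolynomial F n c = ∑ i : Fin n, C (c i) * X ^ (i : ℕ) := rfl

theorem mem_cyclicCode_iff {n : ℕ} {g : F[X]} (hg : g ∣ X ^ n - 1) (c : Fin n → F) :
    c ∈ cyclicCode n g ↔ g ∣ wordPolynomial F n c := by
  have h1 : c ∈ cyclicCode n g ↔
      Ideal.Quotient.mk (Ideal.span {(X ^ n - 1 : F[X])}) (wordPolynomial F n c) ∈
        (Ideal.span {g}).map (Ideal.Quotient.mk (Ideal.span {(X ^ n - 1 : F[X])})) := by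
    rw [Ideal.map_span, Set.image_singleton]; rfl
  rw [h1, Ideal.mem_quotient_iff_mem, Ideal.mem_span_singleton]
  rwa [Ideal.span_singleton_le_span_singleton]

theorem exists_wordPolynomial_eq {n : ℕ} {p : F[X]} (hp : p.degree < n) :
    ∃ c, wordPolynomial F n c = p := by
  refine ⟨fun i ↦ p.coeff i, ?_⟩
  rw [wordPolynomial_apply, Fin.sum_univ_eq_sum_range (fun i ↦ C (p.coeff i) * X ^ i)]
  ext k
  simp only [finsetSum_coeff, coeff_C_mul_X_pow]
  rw [Finset.sum_ite_eq]
  split_ifs with hk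
  · rfl
  · rw [Finset.mem_range, not_lt] at hk
    exact (coeff_eq_zero_of_degree_lt (hp.trans_le (by exact_mod_cast hk))).symm

/-- The code is the kernel of the map from words to F[X]/(g), which is onto because remainders
modulo g have degree below n. -/
theorem finrank_cyclicCode {n : ℕ} (hn : 0 < n) {g : F[X]} (hmon : g.Monic) (hg : g ∣ X ^ n - 1) :
    Module.finrank F (cyclicCode n g) + g.natDegree = n := by
  let φ : (Fin n → F) →ₗ[F] F[X] ⧸ Ideal.span {g} :=
    (Ideal.Quotient.mkₐ F (Ideal.span {g})).toLinearMap ∘ₗ wordPolynomial F n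
  have hker : LinearMap.ker φ = cyclicCode n g := by
    ext c
    rw [mem_cyclicCode_iff hg, LinearMap.mem_ker, ← Ideal.mem_span_singleton,
      ← Ideal.Quotient.eq_zero_iff_mem]
    rfl
  have hdeg : g.degree ≤ n := by
    have h1 : (X ^ n - 1 : F[X]) ≠ 0 := (monic_X_pow_sub_C (1 : F) hn.ne').ne_zero
    refine (degree_le_of_dvd hg h1).trans_eq ?_
    simpa using degree_X_pow_sub_C hn (1 : F)
  have hsurj : LinearMap.range φ = ⊤ := by
    rw [LinearMap.range_eq_top]
    intro y
    obtain ⟨p, rfl⟩ := Ideal.Quotient.mk_surjective y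
    obtain ⟨c, hc⟩ := exists_wordPolynomial_eq ((degree_modByMonic_lt p hmon).trans_le hdeg)
    refine ⟨c, ?_⟩
    change Ideal.Quotient.mk _ (wordPolynomial F n c) = _
    rw [hc, Ideal.Quotient.eq, Ideal.mem_span_singleton]
    have := modByMonic_add_div p g
    exact ⟨-(p /ₘ g), by linear_combination this⟩
  have h := LinearMap.finrank_range_add_finrank_ker φ
  rw [hker, hsurj, finrank_top, finrank_quotient_span_eq_natDegree, Module.finrank_fin_fun] at h
  omega

/-- The BCH bound: a nonzero word whose polynomial vanishes at `s` consecutive powers of `ζ` has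
weight larger than `s`. -/
theorem lt_hammingNorm_of_consecutive_roots [DecidableEq F] {n : ℕ} {ζ : K}
    (hζ : IsPrimitiveRoot ζ n) {c : Fin n → F} (hc : c ≠ 0) (b : ℤ) (s : ℕ)
    (hroot : ∀ k : ℕ, k < s → aeval (ζ ^ (b + k)) (wordPolynomial F n c) = 0) :
    s < hammingNorm c := by
  classical
  by_contra! hle
  obtain ⟨i₀, hi₀⟩ := Function.ne_iff.1 hc
  have hn : 0 < n := i₀.pos
  have h0 := hζ.ne_zero hn.ne'
  let S : Finset (Fin n) := {i | c i ≠ 0}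
  have hS : S.card ≤ s := hle
  have hi₀S : i₀ ∈ S := by simpa [S] using hi₀
  let d : Fin n → K := fun i ↦ algebraMap F K (c i) * ζ ^ (b * (i : ℕ))
  have hmoment : ∀ k : ℕ, k < s → ∑ i, d i * (ζ ^ (i : ℕ)) ^ k = 0 := by
    intro k hk
    rw [← hroot k hk, wordPolynomial_apply, map_sum]
    refine Finset.sum_congr rfl fun i _ ↦ ?_
    rw [map_mul, aeval_C, map_pow, aeval_X, mul_assoc]
    congr 1
    rw [← zpow_natCast ζ, ← zpow_natCast (ζ ^ ((i : ℕ) : ℤ)), ← zpow_mul, ← zpow_add₀ h0,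
      ← zpow_natCast (ζ ^ (b + (k : ℤ))), ← zpow_mul]
    congr 1
    ring
  -- In place of a Vandermonde determinant: P vanishes at every support point but that of i₀, and
  -- deg P < s makes the weighted sum of its values a combination of vanishing moments. Only the
  -- nonzero i₀ term survives.
  let P : K[X] := ∏ j ∈ S.erase i₀, (X - C (ζ ^ (j : ℕ)))
  have hPdeg : P.natDegree < s := by
    rw [natDegree_prod_of_monic _ _ fun j _ ↦ monic_X_sub_C _]
    simp only [natDegree_X_sub_C, Finset.sum_const, smul_eq_mul, mul_one]
    exact (Finset.card_erase_lt_of_mem hi₀S).trans_le hS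
  have hsum : ∑ i, d i * P.eval (ζ ^ (i : ℕ)) = 0 := by
    simp_rw [eval_eq_sum_range, Finset.mul_sum]
    rw [Finset.sum_comm]
    refine Finset.sum_eq_zero fun k hk ↦ ?_
    have hk' : k < s := by rw [Finset.mem_range] at hk; omega
    calc ∑ i, d i * (P.coeff k * (ζ ^ (i : ℕ)) ^ k)
        = P.coeff k * ∑ i, d i * (ζ ^ (i : ℕ)) ^ k := by
          rw [Finset.mul_sum]; exact Finset.sum_congr rfl fun i _ ↦ by ring
      _ = 0 := by rw [hmoment k hk', mul_zero]
  rw [Finset.sum_eq_single i₀] at hsum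
  · rcases mul_eq_zero.1 hsum with h | h
    · rcases mul_eq_zero.1 h with h | h
      · exact hi₀ (by simpa using h)
      · exact zpow_ne_zero _ h0 h
    · rw [eval_prod, Finset.prod_eq_zero_iff] at h
      obtain ⟨j, hj, hj0⟩ := h
      rw [eval_sub, eval_X, eval_C, sub_eq_zero] at hj0
      exact Finset.ne_of_mem_erase hj (Fin.ext (hζ.pow_inj j.2 i₀.2 hj0.symm))
  · intro i _ hi
    by_cases hiS : i ∈ S
    · refine mul_eq_zero_of_right _ ?_
      rw [eval_prod]
      exact Finset.prod_eq_zero (Finset.mem_erase.2 ⟨hi, hiS⟩) (by simp)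
    · have : c i = 0 := by simpa [S] using hiS
      simp [d, this]
  · simp

theorem le_minDist_of_consecutive_roots {n : ℕ} {ζ : K} (hζ : IsPrimitiveRoot ζ n) {g : F[X]}
    (hg : g ∣ X ^ n - 1) (b : ℤ) (s : ℕ)
    (hroot : ∀ k : ℕ, k < s → aeval (ζ ^ (b + k)) g = 0) :
    ((s + 1 : ℕ) : ℕ∞) ≤ minDist (cyclicCode n g) := by
  classical
  refine le_iInf fun x ↦ le_iInf fun hx ↦ le_iInf fun y ↦ le_iInf fun hy ↦ le_iInf fun hxy ↦ ?_
  have hmem := (mem_cyclicCode_iff hg _).1 (sub_mem hx hy)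
  have h := lt_hammingNorm_of_consecutive_roots hζ (sub_ne_zero.2 hxy) b s fun k hk ↦
    aeval_eq_zero_of_dvd_aeval_eq_zero hmem (hroot k hk)
  have heq : hammingNorm (x - y) = hammingDist x y := by
    simp only [hammingNorm, hammingDist, Pi.sub_apply, sub_ne_zero]
  rw [heq] at h
  convert! (Nat.cast_le (α := ℕ∞)).2 (Nat.succ_le_of_lt h)

/-! ### Weighted count of exponents. -/

theorem card_filter_not_dvd_add_div (q d : ℕ) :
    (Finset.Icc 1 d |>.filter (¬ q ∣ ·)).card + d / q = d := by
  have h := Finset.card_filter_add_card_filter_not (s := Finset.Icc 1 d) (q ∣ ·)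
  have h1 : (Finset.Icc 1 d |>.filter (q ∣ ·)).card = d / q := Nat.Ioc_filter_dvd_card_eq_div d q
  rw [h1, Nat.card_Icc] at h
  omega

theorem sub_one_ediv {d : ℕ} (hd : 0 < d) (q : ℕ) :
    ((d : ℤ) - 1) / q = (d : ℤ) / q - if q ∣ d then 1 else 0 := by
  obtain ⟨e, rfl⟩ : ∃ e, d = e + 1 := ⟨d - 1, by omega⟩
  have h := Nat.succ_div (a := e) (b := q)
  have h1 : ((e + 1 : ℕ) : ℤ) - 1 = (e : ℤ) := by push_cast; ring
  rw [h1, ← Int.natCast_div, ← Int.natCast_div, h]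
  split_ifs <;> push_cast <;> ring

/-- Among `1, …, d`, the numbers prime to `q` are counted with weight `2`, or with weight `1` if
they are multiples of `l`. -/
theorem two_mul_card_add_card {q l d : ℕ} (hql : q.Coprime l) (hd : 0 < d)
    (hld : l ∣ d) :
    (2 * (Finset.Icc 1 d |>.filter fun γ ↦ ¬ q ∣ γ ∧ ¬ l ∣ γ).card
      + (Finset.Icc 1 d |>.filter fun γ ↦ ¬ q ∣ γ ∧ l ∣ γ).card : ℤ)
    = 2 * d - (d : ℤ) / l - ((d : ℤ) - 1) / q - (d : ℤ) / q + ((d : ℤ) - 1) / (l * q) := by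
  have h1 := card_filter_not_dvd_add_div q d
  have h2 := Finset.card_filter_add_card_filter_not
    (s := Finset.Icc 1 d |>.filter (¬ q ∣ ·)) (l ∣ ·)
  have h3 := Finset.card_filter_add_card_filter_not
    (s := Finset.Icc 1 d |>.filter (l ∣ ·)) (q ∣ ·)
  have h4 : (Finset.Icc 1 d |>.filter (l ∣ ·)).card = d / l := Nat.Ioc_filter_dvd_card_eq_div d l
  have h5 : (Finset.Icc 1 d |>.filter (l * q ∣ ·)).card = d / (l * q) :=
    Nat.Ioc_filter_dvd_card_eq_div d (l * q)
  have h6 : (Finset.Icc 1 d |>.filter fun γ ↦ l ∣ γ ∧ q ∣ γ)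
      = (Finset.Icc 1 d |>.filter (l * q ∣ ·)) := by
    refine Finset.filter_congr fun γ _ ↦ ⟨fun h ↦ hql.symm.mul_dvd_of_dvd_of_dvd h.1 h.2,
      fun h ↦ ⟨(dvd_mul_right _ _).trans h, (dvd_mul_left _ _).trans h⟩⟩
  have h7 : (Finset.Icc 1 d |>.filter fun γ ↦ l ∣ γ ∧ ¬ q ∣ γ)
      = (Finset.Icc 1 d |>.filter fun γ ↦ ¬ q ∣ γ ∧ l ∣ γ) :=
    Finset.filter_congr fun γ _ ↦ and_comm
  simp only [Finset.filter_filter] at h2 h3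
  rw [h6, h5, h7, h4] at h3
  -- Hence d / q and d / (l q) jump together between d - 1 and d, and the two corrections cancel.
  have h8 : q ∣ d ↔ l * q ∣ d :=
    ⟨hql.symm.mul_dvd_of_dvd_of_dvd hld, (dvd_mul_left _ _).trans⟩
  have h9 := sub_one_ediv hd q
  have h10 := sub_one_ediv hd (l * q)
  simp only [h8] at h9
  rw [Nat.cast_mul] at h10
  rw [h9, h10]
  rw [← h2] at h1
  replace h1 := congrArg (Nat.cast (R := ℤ)) h1
  replace h3 := congrArg (Nat.cast (R := ℤ)) h3
  simp only [Nat.cast_add, Int.natCast_div, Nat.cast_mul] at h1 h3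
  linarith

end BCH

/-! ### The lcm as a product over coset representatives. -/

namespace BCH

/-- Representatives of the cyclotomic cosets of the exponents of absolute value at most `d`. -/
def cosetReps (q l d : ℕ) : Finset ℤ :=
  (Finset.Icc (-(d : ℤ)) d).filter fun a ↦
    a = 0 ∨ (¬ (q : ℤ) ∣ a ∧ (¬ (l : ℤ) ∣ a ∨ 0 < a))

theorem mem_cosetReps {q l d : ℕ} {a : ℤ} :
    a ∈ cosetReps q l d ↔ |a| ≤ d ∧ (a = 0 ∨ (¬ (q : ℤ) ∣ a ∧ (¬ (l : ℤ) ∣ a ∨ 0 < a))) := by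
  rw [cosetReps, Finset.mem_filter, Finset.mem_Icc, abs_le]

/-- A general monoid allows two uses: the product of the polynomials and, through `Multiplicative`,
the sum of their degrees. -/
theorem prod_cosetReps {M : Type*} [CommMonoid M] (q l d : ℕ) (f : ℤ → M) :
    ∏ a ∈ cosetReps q l d, f a = f 0
      * (∏ γ ∈ Finset.Icc 1 d with ¬ q ∣ γ ∧ ¬ l ∣ γ, f (γ : ℤ) * f (-(γ : ℤ)))
      * (∏ γ ∈ Finset.Icc 1 d with ¬ q ∣ γ ∧ l ∣ γ, f (γ : ℤ)) := by
  let c : ℕ ↪ ℤ := Nat.castEmbedding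
  let c' : ℕ ↪ ℤ := c.trans (Equiv.neg ℤ).toEmbedding
  let A := (Finset.Icc 1 d).filter fun γ ↦ ¬ q ∣ γ ∧ ¬ l ∣ γ
  let B := (Finset.Icc 1 d).filter fun γ ↦ ¬ q ∣ γ ∧ l ∣ γ
  have hA : ∀ a, a ∈ A.map c ↔ 0 < a ∧ a ≤ d ∧ ¬ (q : ℤ) ∣ a ∧ ¬ (l : ℤ) ∣ a := by
    intro a
    simp only [Finset.mem_map, A, Finset.mem_filter, Finset.mem_Icc, c, Nat.castEmbedding_apply]
    constructor
    · rintro ⟨γ, ⟨⟨h1, h2⟩, h3, h4⟩, rfl⟩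
      exact ⟨by omega, by omega, by rwa [Int.natCast_dvd_natCast], by rwa [Int.natCast_dvd_natCast]⟩
    · rintro ⟨h1, h2, h3, h4⟩
      lift a to ℕ using h1.le
      rw [Int.natCast_dvd_natCast] at h3 h4
      exact ⟨a, ⟨⟨by omega, by omega⟩, h3, h4⟩, rfl⟩
  have hB : ∀ a, a ∈ B.map c ↔ 0 < a ∧ a ≤ d ∧ ¬ (q : ℤ) ∣ a ∧ (l : ℤ) ∣ a := by
    intro a
    simp only [Finset.mem_map, B, Finset.mem_filter, Finset.mem_Icc, c, Nat.castEmbedding_apply]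
    constructor
    · rintro ⟨γ, ⟨⟨h1, h2⟩, h3, h4⟩, rfl⟩
      exact ⟨by omega, by omega, by rwa [Int.natCast_dvd_natCast], by rwa [Int.natCast_dvd_natCast]⟩
    · rintro ⟨h1, h2, h3, h4⟩
      lift a to ℕ using h1.le
      rw [Int.natCast_dvd_natCast] at h3 h4
      exact ⟨a, ⟨⟨by omega, by omega⟩, h3, h4⟩, rfl⟩
  have hA' : ∀ a, a ∈ A.map c' ↔ -a ∈ A.map c := by
    intro a
    rw [← Finset.map_map, Finset.mem_map_equiv]
    rfl
  have hT : cosetReps q l d = insert 0 ((A.map c ∪ A.map c') ∪ B.map c) := by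
    ext a
    rw [mem_cosetReps, Finset.mem_insert, Finset.mem_union, Finset.mem_union, hA', hA, hA, hB,
      dvd_neg, dvd_neg, abs_le]
    constructor
    · rintro ⟨⟨h1, h2⟩, rfl | ⟨h3, h4⟩⟩
      · exact Or.inl rfl
      · have h0 : a ≠ 0 := by rintro rfl; exact h3 (dvd_zero _)
        rcases lt_or_gt_of_ne h0 with h | h <;> by_cases hl : (l : ℤ) ∣ a <;> simp only [h3, hl] <;>
          grind
    · rintro (rfl | (h | h) | h)
      · simp
      all_goals exact ⟨⟨by omega, by omega⟩, by tauto⟩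
  rw [hT, Finset.prod_insert, Finset.prod_union, Finset.prod_union, Finset.prod_map,
    Finset.prod_map, Finset.prod_map, ← Finset.prod_mul_distrib, ← mul_assoc]
  · rfl
  · rw [Finset.disjoint_left]
    intro a h1 h2
    rw [hA', hA] at h2
    rw [hA] at h1
    omega
  · rw [Finset.disjoint_left]
    intro a h1 h2
    rw [Finset.mem_union, hA', hA, hA, dvd_neg, dvd_neg] at h1
    rw [hB] at h2
    tauto
  · rw [Finset.mem_union, Finset.mem_union, hA', hA, hA, hB]
    simp

variable {F : Type*} [Field F] {K : Type*} [Field K] [Algebra F K]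

theorem minPoly_zero (ζ : K) : minPoly F ζ 0 = X - 1 := by
  rw [minPoly, zpow_zero, minpoly.one]

theorem isCoprime_minPoly {n : ℕ} {ζ : K} (hζ : IsPrimitiveRoot ζ n) (hn : 0 < n) {a b : ℤ}
    (h : minPoly F ζ a ≠ minPoly F ζ b) : IsCoprime (minPoly F ζ a) (minPoly F ζ b) := by
  rw [(minPoly_irreducible hζ hn a).coprime_iff_not_dvd]
  intro hdvd
  exact h (eq_of_monic_of_associated (minPoly_monic hζ hn a) (minPoly_monic hζ hn b)
    ((minPoly_irreducible hζ hn a).associated_of_dvd (minPoly_irreducible hζ hn b) hdvd))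

theorem minPoly_add_length {n : ℕ} {ζ : K} (hζ : IsPrimitiveRoot ζ n) (hn : 0 < n) (a : ℤ) :
    minPoly F ζ (a + n) = minPoly F ζ a := by
  unfold minPoly
  rw [(zpow_eq_zpow_iff_dvd hζ hn _ _).2]
  rw [add_sub_cancel_left]

theorem cast_length_eq {q m l n : ℕ} (hn : n = l * (q ^ m + 1)) :
    (n : ℤ) = l * ((q : ℤ) ^ m + 1) := by
  rw [hn]; push_cast; ring

section

variable [Fintype F] {q m l d n : ℕ} {ζ : K}

theorem SmallExponents.dvd_pow_sub_one (h : SmallExponents q l d m) (hn : n = l * (q ^ m + 1)) :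
    (n : ℤ) ∣ (q : ℤ) ^ (2 * m) - 1 := by
  obtain ⟨c, hc⟩ : (l : ℤ) ∣ (q : ℤ) ^ m - 1 :=
    h.dvd_pred.trans (by simpa using sub_dvd_pow_sub_pow (q : ℤ) 1 m)
  refine ⟨c, ?_⟩
  have : (q : ℤ) ^ (2 * m) - 1 = ((q : ℤ) ^ m - 1) * ((q : ℤ) ^ m + 1) := by ring
  rw [this, hc, hn]
  push_cast
  ring

theorem SmallExponents.pos (h : SmallExponents q l d m) (hn : n = l * (q ^ m + 1)) : 0 < n := by
  have := h.one_le
  rw [hn]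
  exact Nat.mul_pos (by omega) (by positivity)

theorem SmallExponents.injOn_minPoly (h : SmallExponents q l d m) (hm : 0 < m)
    (hn : n = l * (q ^ m + 1)) (hq : Fintype.card F = q) (hζ : IsPrimitiveRoot ζ n) :
    Set.InjOn (minPoly F ζ) (cosetReps q l d) := by
  have hn0 := h.pos hn
  have key : ∀ a b : ℤ, |b| ≤ d → a = 0 → minPoly F ζ a = minPoly F ζ b → a = b := by
    rintro a b hb rfl hab
    obtain ⟨i, -, hi⟩ := exists_dvd_of_minPoly_eq hq hζ hn0 (r := 2 * m) (by omega)
      (h.dvd_pow_sub_one hn) hab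
    rw [zero_mul, zero_sub, dvd_neg] at hi
    refine (Int.eq_zero_of_abs_lt_dvd hi ?_).symm
    have := h.two_mul_lt
    rw [cast_length_eq hn]
    linarith [abs_nonneg b]
  intro a ha b hb hab
  rw [Finset.mem_coe, mem_cosetReps] at ha hb
  obtain ⟨ha, ha0 | ⟨hqa, ha'⟩⟩ := ha
  · exact key a b hb.1 ha0 hab
  obtain ⟨hb, hb0 | ⟨hqb, hb'⟩⟩ := hb
  · exact (key b a ha hb0 hab.symm).symm
  obtain ⟨i, hir, hi⟩ := exists_dvd_of_minPoly_eq hq hζ hn0 (r := 2 * m) (by omega)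
      (h.dvd_pow_sub_one hn) hab
  rw [cast_length_eq hn] at hi
  rcases h.rigid ha hb hqa hqb hir hi with h1 | ⟨-, rfl, h1⟩
  · exact h1.2
  -- If i = m, both exponents are multiples of l, so the sign convention makes a and -a positive.
  · rw [dvd_neg] at hb'
    have h2 := hb'.resolve_left (not_not.2 h1)
    have h3 := ha'.resolve_left (not_not.2 h1)
    omega

theorem SmallExponents.natDegree_minPoly (h : SmallExponents q l d m) (hm : 0 < m)
    (hn : n = l * (q ^ m + 1)) (hq : Fintype.card F = q) (hζ : IsPrimitiveRoot ζ n) {a : ℤ}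
    (ha : |a| ≤ d) (hqa : ¬ (q : ℤ) ∣ a) : (minPoly F ζ a).natDegree = 2 * m := by
  refine BCH.natDegree_minPoly hq hζ (h.pos hn) (by omega) (h.dvd_pow_sub_one hn)
    fun i hi0 hi hdvd ↦ ?_
  rw [cast_length_eq hn] at hdvd
  rcases h.rigid ha ha hqa hqa hi hdvd with h1 | ⟨-, h1, -⟩
  · omega
  · obtain rfl : a = 0 := by omega
    exact hqa (dvd_zero _)

/-- Divide out the powers of q; if this leaves a negative multiple of l, change its sign, which
multiplication by q^m does modulo n. -/
theorem SmallExponents.exists_mem_cosetReps (h : SmallExponents q l d m)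
    (hn : n = l * (q ^ m + 1)) (hq : Fintype.card F = q) (hζ : IsPrimitiveRoot ζ n) {c : ℤ}
    (hc : |c| ≤ d) : ∃ a ∈ cosetReps q l d, minPoly F ζ a = minPoly F ζ c := by
  have hn0 := h.pos hn
  rcases eq_or_ne c 0 with rfl | hc0
  · exact ⟨0, mem_cosetReps.2 ⟨hc, Or.inl rfl⟩, rfl⟩
  have hq2 := h.two_le
  have hfin : FiniteMultiplicity (q : ℤ) c := Int.finiteMultiplicity_iff.2 ⟨by omega, hc0⟩
  obtain ⟨a, hca, hqa⟩ := hfin.exists_eq_pow_mul_and_not_dvd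
  generalize multiplicity (q : ℤ) c = e at hca
  have hac : minPoly F ζ a = minPoly F ζ c :=
    minPoly_eq_of_dvd hq hζ hn0 (i := e) (by rw [hca, mul_comm, sub_self]; exact dvd_zero _)
  have had : |a| ≤ d := by
    refine le_trans ?_ hc
    rw [hca, abs_mul]
    refine le_mul_of_one_le_left (abs_nonneg a) (Int.one_le_abs (pow_ne_zero _ (by omega)))
  by_cases hla : (l : ℤ) ∣ a ∧ a < 0
  · refine ⟨-a, mem_cosetReps.2 ⟨by rwa [abs_neg], Or.inr ⟨by rwa [dvd_neg], Or.inr (neg_pos.2 hla.2)⟩⟩, ?_⟩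
    rw [← hac]
    refine minPoly_eq_of_dvd hq hζ hn0 (i := m) ?_
    rw [cast_length_eq hn, show -a * (q : ℤ) ^ m - a = -a * ((q : ℤ) ^ m + 1) by ring]
    exact mul_dvd_mul_right ((dvd_neg).2 hla.1) _
  · refine ⟨a, mem_cosetReps.2 ⟨had, Or.inr ⟨hqa, ?_⟩⟩, hac⟩
    have : a ≠ 0 := by rintro rfl; exact hqa (dvd_zero _)
    by_cases hl : (l : ℤ) ∣ a
    · exact Or.inr (lt_of_le_of_ne (not_lt.1 fun h' ↦ hla ⟨hl, h'⟩) this.symm)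
    · exact Or.inl hl

theorem SmallExponents.bchPolynomial_eq_prod (h : SmallExponents q l d m) (hm : 0 < m)
    (hn : n = l * (q ^ m + 1)) (hq : Fintype.card F = q) (hζ : IsPrimitiveRoot ζ n)
    (hd : 0 < d) :
    bchPolynomial F ζ (2 * d + 1) ((n : ℤ) - d + 1)
      = ∏ a ∈ cosetReps q l d, minPoly F ζ a := by
  have hn0 := h.pos hn
  refine bchPolynomial_eq_of_monic (monic_prod_of_monic _ _ fun a _ ↦ minPoly_monic hζ hn0 a)
    ((bchPolynomial_dvd_iff _ _ _ _).2 fun c hc ↦ ?_) (Finset.prod_dvd_of_coprime ?_ ?_)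
  · rw [Finset.mem_Icc] at hc
    push_cast at hc
    have hc' : |c - n| ≤ d := abs_le.2 ⟨by omega, by omega⟩
    obtain ⟨a, ha, hac⟩ := h.exists_mem_cosetReps hn hq hζ hc'
    rw [← sub_add_cancel c (n : ℤ), minPoly_add_length hζ hn0, ← hac]
    exact Finset.dvd_prod_of_mem _ ha
  · intro a ha b hb hab
    exact isCoprime_minPoly hζ hn0 fun heq ↦ hab (h.injOn_minPoly hm hn hq hζ ha hb heq)
  · intro a ha
    rw [← minPoly_add_length hζ hn0]
    refine (bchPolynomial_dvd_iff ζ (2 * d + 1) ((n : ℤ) - d + 1) _).1 dvd_rfl _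
      (Finset.mem_Icc.2 ?_)
    rw [mem_cosetReps, abs_le] at ha
    -- The window n - d + 1, …, n + d misses only -d, a negative multiple of l and so not a
    -- representative.
    have : a ≠ -d := by
      rintro rfl
      rcases ha.2 with h1 | ⟨-, h1 | h1⟩
      · omega
      · exact h1 ((dvd_neg).2 h.dvd)
      · omega
    push_cast
    omega

end

end BCH
end

/-! ### Dimension, distance and generator polynomial. -/

theorem mainTheorem7 {F : Type*} [Field F] [Fintype F] {K : Type*} [Field K] [Algebra F K]
    (q n m lam δ : ℕ)
    (hq : Fintype.card F = q)
    (hm : 2 ≤ m)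
    (hlam : lam ∣ q - 1)
    (hn : n = lam * (q ^ m + 1))
    (ζ : K) (hζ : IsPrimitiveRoot ζ n)
    (hδ : lam ∣ δ)
    (hδ_lower : lam ≤ δ)
    (hδ_even : Even m → δ ≤ lam * q ^ (m / 2) - 1)
    (hδ_odd : Odd m → δ ≤ lam * (q ^ ((m - 1) / 2) + q) - 1)
    (hm2 : m = 2 → Even q ∨ (Odd q ∧ lam ≤ (q - 1) / 2))
    (hm2' : m = 2 → Even q → lam = q - 1 → 2 * δ < q * (q + 1))
    (hm3 : m = 3 → lam ≤ (q + 1) / 2)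
    (hm3' : m = 3 → lam = (q + 1) / 2 → δ ≤ q ^ 2 - q) :
    (Module.finrank F (BCH.bchCode F n ζ (2 * δ + 1) ((n : ℤ) - δ + 1)) : ℤ)
        = lam * q ^ m
          - 2 * m * (2 * δ - (δ : ℤ) / lam - ((δ : ℤ) - 1) / q - (δ : ℤ) / q
              + ((δ : ℤ) - 1) / (lam * q))
          + lam - 1 ∧
    ((2 * (δ + 1) : ℕ) : ℕ∞) ≤
        BCH.minDist (BCH.bchCode F n ζ (2 * δ + 1) ((n : ℤ) - δ + 1)) ∧
    BCH.IsGeneratorPolynomial (BCH.bchCode F n ζ (2 * δ + 1) ((n : ℤ) - δ + 1))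
        (BCH.bchPolynomial F ζ (2 * δ + 1) ((n : ℤ) - δ + 1)) ∧
    BCH.bchPolynomial F ζ (2 * δ + 1) ((n : ℤ) - δ + 1)
        = (Polynomial.X - 1)
          * (∏ γ ∈ Finset.Icc 1 δ with ¬ q ∣ γ ∧ ¬ lam ∣ γ,
              BCH.minPoly F ζ (γ : ℤ) * BCH.minPoly F ζ (-(γ : ℤ)))
          * (∏ γ ∈ Finset.Icc 1 δ with ¬ q ∣ γ ∧ lam ∣ γ, BCH.minPoly F ζ (γ : ℤ)) := by
  have hq2 : 2 ≤ q := hq ▸ Fintype.one_lt_card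
  have h := BCH.smallExponents_of_bounds q m lam δ hq2 hm hlam hδ hδ_even hδ_odd hm2 hm2' hm3 hm3'
  have hl : 0 < lam := Nat.pos_of_dvd_of_pos hlam (by omega)
  have hδ0 : 0 < δ := by omega
  have hm0 : 0 < m := by omega
  have hn0 := h.pos hn
  have hprod := h.bchPolynomial_eq_prod hm0 hn hq hζ hδ0
  have hform := hprod
  rw [BCH.prod_cosetReps, BCH.minPoly_zero] at hform
  have hmonic : (BCH.bchPolynomial F ζ (2 * δ + 1) ((n : ℤ) - δ + 1)).Monic := by
    rw [hprod]
    exact monic_prod_of_monic _ _ fun a _ ↦ BCH.minPoly_monic hζ hn0 a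
  have hdvd : BCH.bchPolynomial F ζ (2 * δ + 1) ((n : ℤ) - δ + 1) ∣ X ^ n - 1 :=
    (BCH.bchPolynomial_dvd_iff _ _ _ _).2 fun a _ ↦ BCH.minPoly_dvd_X_pow_sub_one hζ a
  refine ⟨?_, ?_, ⟨hmonic, hdvd, rfl⟩, hform⟩
  · have hql : q.Coprime lam := by
      refine Nat.Coprime.coprime_dvd_right hlam ?_
      rw [Nat.coprime_self_sub_right (by omega)]
      exact Nat.coprime_one_right q
    have hdim := BCH.finrank_cyclicCode hn0 hmonic hdvd
    have hdeg : (BCH.bchPolynomial F ζ (2 * δ + 1) ((n : ℤ) - δ + 1)).natDegree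
        = 1 + 2 * m * (2 * (Finset.Icc 1 δ |>.filter fun γ ↦ ¬ q ∣ γ ∧ ¬ lam ∣ γ).card
          + (Finset.Icc 1 δ |>.filter fun γ ↦ ¬ q ∣ γ ∧ lam ∣ γ).card) := by
      have hdeg0 : (BCH.minPoly F ζ 0).natDegree = 1 := by
        rw [BCH.minPoly_zero, ← C_1, natDegree_X_sub_C]
      have hdeg' : ∀ γ : ℕ, γ ∈ Finset.Icc 1 δ → ¬ q ∣ γ →
          (BCH.minPoly F ζ (γ : ℤ)).natDegree = 2 * m ∧
          (BCH.minPoly F ζ (-(γ : ℤ))).natDegree = 2 * m := by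
        intro γ hγ hqγ
        rw [Finset.mem_Icc] at hγ
        have h1 : |(γ : ℤ)| ≤ δ := by rw [Nat.abs_cast]; exact_mod_cast hγ.2
        have h2 : ¬ (q : ℤ) ∣ γ := by rwa [Int.natCast_dvd_natCast]
        exact ⟨h.natDegree_minPoly hm0 hn hq hζ h1 h2,
          h.natDegree_minPoly hm0 hn hq hζ (by rwa [abs_neg]) (by rwa [dvd_neg])⟩
      rw [hprod, natDegree_prod_of_monic _ _ fun a _ ↦ BCH.minPoly_monic hζ hn0 a]
      have hsum := BCH.prod_cosetReps q lam δ fun a ↦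
        Multiplicative.ofAdd (BCH.minPoly F ζ a).natDegree
      rw [← ofAdd_sum, Finset.prod_congr rfl (g := fun _ ↦ Multiplicative.ofAdd (2 * m + 2 * m)),
        Finset.prod_congr (s₂ := Finset.Icc 1 δ |>.filter fun γ ↦ ¬ q ∣ γ ∧ lam ∣ γ) rfl
          (g := fun _ ↦ Multiplicative.ofAdd (2 * m)), hdeg0, Finset.prod_const,
        Finset.prod_const] at hsum
      · rw [← ofAdd_nsmul, ← ofAdd_nsmul, ← ofAdd_add, ← ofAdd_add] at hsum
        rw [Multiplicative.ofAdd.injective hsum, smul_eq_mul, smul_eq_mul]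
        ring
      · intro γ hγ
        rw [Finset.mem_filter] at hγ
        rw [(hdeg' γ hγ.1 hγ.2.1).1]
      · intro γ hγ
        rw [Finset.mem_filter] at hγ
        rw [(hdeg' γ hγ.1 hγ.2.1).1, (hdeg' γ hγ.1 hγ.2.1).2, ofAdd_add]
    have hcount := BCH.two_mul_card_add_card hql hδ0 hδ
    rw [← hcount]
    rw [hdeg] at hdim
    replace hdim := congrArg (Nat.cast (R := ℤ)) hdim
    simp only [Nat.cast_add, Nat.cast_mul, Nat.cast_one, Nat.cast_ofNat] at hdim
    have hlen := BCH.cast_length_eq hn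
    rw [BCH.bchCode]
    linarith
  -- The roots run over -δ, …, δ, one exponent more than the definition of the code imposes.
  · have hbound := BCH.le_minDist_of_consecutive_roots hζ hdvd (-(δ : ℤ)) (2 * δ + 1) ?_
    · exact hbound
    · intro k hk
      obtain ⟨a, ha, hac⟩ := h.exists_mem_cosetReps hn hq hζ (c := -(δ : ℤ) + k)
        (abs_le.2 ⟨by omega, by omega⟩)
      refine aeval_eq_zero_of_dvd_aeval_eq_zero (p := BCH.minPoly F ζ a) ?_ ?_
      · rw [hprod]
        exact Finset.dvd_prod_of_mem _ ha
      · rw [hac]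
        exact minpoly.aeval F _
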